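/- For $x\in\mathbb{R}$ let $\|x\|$ denote the distance from $x$ to the nearest integer. Let $n\ge 1$, let $\theta=(\theta_1,\ldots,\theta_n)\in\mathbb{R}^n$ be arbitrary, and let $j_1,\ldots,j_n>0$ be real numbers with $\sum_{i=1}^n j_i=1$. Put $$\mathrm{Bad}_\theta(j_1,\ldots,j_n)=\Big\{\eta\in\mathbb{R}^n:\ \inf_{q\ge 1}\ \max_{1\le i\le n} q^{j_i}\|q\theta_i-\eta_i\|>0\Big\},$$ where $q$ runs over the positive integers. For weights $k_1,\ldots,k_n\ge 0$ with $\sum_{i=1}^n k_i=1$ put $$\mathrm{Bad}(k_1,\ldots,k_n)=\Big\{x\in\mathbb{R}^n:\ \inf_{q\ge 1}\ \max_{i:\,k_i>0} q^{k_i}\|qx_i\|>0\Big\},$$ so that $\mathrm{Bad}(1,0,\ldots,0),\ldots,\mathrm{Bad}(0,\ldots,0,1)$ are the sets of $x\in\mathbb{R}^n$ whose first, ..., $n$-th coordinate, respectively, is a badly approximable number. Then $$\dim\big(\mathrm{Bad}_\theta(j_1,\ldots,j_n)\cap\mathrm{Bad}(1,0,\ldots,0)\cap\cdots\cap\mathrm{Bad}(0,\ldots,0,1)\big)=n,$$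 where $\dim$ is the Hausdorff dimension. In particular $\dim \mathrm{Bad}_\theta(j_1,\ldots,j_n)=n$ for every $\theta\in\mathbb{R}^n$. -/

import Mathlib

noncomputable section

/-- The distance `‖x‖` from a real number to the nearest integer. -/
def distNearestInt (x : ℝ) : ℝ := |x - (round x : ℝ)|

/-- The set `Bad(j₁, …, jₙ)` of `(j₁, …, jₙ)`-badly approximable vectors, for weights `jᵢ ≥ 0`:
those `x` with `inf_{q ≥ 1} max_i q ^ jᵢ * ‖q xᵢ‖ > 0`. Equivalently
`max_i ‖q xᵢ‖ ^ (1 / jᵢ) ≥ c / q` for some `c > 0` and all `q ≥ 1`; by the usual convention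
`‖q xᵢ‖ ^ (1 / 0) = 0`, coordinates of weight zero impose nothing, so that the maximum runs over
the coordinates of positive weight. -/
def Bad {n : ℕ} (j : Fin n → ℝ) : Set (EuclideanSpace ℝ (Fin n)) :=
  {x | 0 < ⨅ q : ℕ+, ⨆ i : {i : Fin n // 0 < j i},
    ((q : ℕ) : ℝ) ^ j i * distNearestInt (((q : ℕ) : ℝ) * x i)}

/-- The twisted set `Bad_θ(j₁, …, jₙ)`, for positive weights `jᵢ`: those `η` with
`inf_{q ≥ 1} max_i q ^ jᵢ * ‖q θᵢ - ηᵢ‖ > 0`. -/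
def twistedBad {n : ℕ} (θ : EuclideanSpace ℝ (Fin n)) (j : Fin n → ℝ) :
    Set (EuclideanSpace ℝ (Fin n)) :=
  {η | 0 < ⨅ q : ℕ+, ⨆ i : Fin n,
    ((q : ℕ) : ℝ) ^ j i * distNearestInt (((q : ℕ) : ℝ) * θ i - η i)}

end

/-! ### Cantor sets built from anisotropic boxes -/

noncomputable section Cantor

open MeasureTheory Set
open scoped ENNReal NNReal

variable {ι : Type*}

/-! Fix a large `R` and put `a i = R ^ j i`, so that `∏ a i = R`. Boxes of level `t` have sides `a i
^ (-t)` and are cut into `∏ ⌊a i⌋₊` subboxes. If at most half of the subboxes of each box are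
discarded, the uniform measure on surviving branches gives a box of level `t` at most `C ^ t` times
its volume, with `C` depending only on `n`. Counting boxes by volume, the mass distribution
principle yields any dimension `s < n` once all `a i` are large, although the boxes are not cubes
(`exists_dimH_ge_forall_notMem`).

The twisted condition is reached by transference. Let `v m` minimise `‖v·θ‖` over nonzero integer
vectors with `|v i| ≤ a i ^ m`; by Dirichlet the minimum is at most `2 / R ^ m`. In `v·x = q (v·θ) -
v·(qθ - x)`, if `v·x` stays `δ` away from the integers and `R ^ m` is slightly larger than `4q/δ`,
then some `|v i| ‖qθ_i - x_i‖` is bounded below while `|v i| ≪ q ^ j i`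
(`exists_le_rpow_mul_distNearestInt`). So it suffices to keep the forms `v m` away from integers on
the Cantor set.

On a box of level `m + 1` the form `v m` varies so little that only one integer can matter. Only
those `v m` that are not well inside the previous box are needed, and for these the forbidden slab
is thin relative to the box. Likewise each coordinate has at most one dangerous rational per box.
This makes `n + 1` slabs, each meeting at most a fraction `1 / (2(n + 1))` of the subboxes
(`ncard_labels_meeting_slab_le`). -/

/-- The side lengths of the boxes of level `t`. -/
def cellSide (a : ι → ℝ) (t : ℕ) : ι → ℝ := fun i => (a i ^ t)⁻¹

/-- The lower corner of the subbox with label `k` of the box of level `t` with lower corner `c`. -/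
def childCorner (a : ι → ℝ) (t : ℕ) (c : ι → ℝ) (k : ι → ℕ) : ι → ℝ :=
  fun i => c i + k i * cellSide a (t + 1) i

/-- The closed box of level `t` with lower corner `c`. -/
def cell (a : ι → ℝ) (t : ℕ) (c : ι → ℝ) : Set (ι → ℝ) := Icc c (c + cellSide a t)

/-- The labels of the subboxes of a box. -/
def labels [Fintype ι] (a : ι → ℝ) : Finset (ι → ℕ) :=
  letI := Classical.decEq ι
  Fintype.piFinset fun i => Finset.range ⌊a i⌋₊

/-- The corner of the box of level `t` on the branch `ω`, where `e` selects labels. -/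
def branchCorner {N : ℕ} (a : ι → ℝ) (e : ℕ → (ι → ℝ) → Fin N → ι → ℕ) (ω : ℕ → Fin N) :
    ℕ → ι → ℝ
  | 0 => 0
  | t + 1 => childCorner a t (branchCorner a e ω t) (e t (branchCorner a e ω t) (ω t))

/-- The limit point of a branch. -/
def branchPoint {N : ℕ} (a : ι → ℝ) (e : ℕ → (ι → ℝ) → Fin N → ι → ℕ) (ω : ℕ → Fin N) :
    ι → ℝ := fun i => ⨆ t, branchCorner a e ω t i

lemma mem_labels [Fintype ι] {a : ι → ℝ} {k : ι → ℕ} : k ∈ labels a ↔ ∀ i, k i < ⌊a i⌋₊ := by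
  classical
  simp [labels]

lemma card_labels [Fintype ι] (a : ι → ℝ) : (labels a).card = ∏ i, ⌊a i⌋₊ := by
  classical
  simp [labels]

lemma cellSide_pos {a : ι → ℝ} (ha : ∀ i, 1 < a i) (t : ℕ) (i : ι) : 0 < cellSide a t i := by
  have := ha i
  unfold cellSide
  positivity

lemma cellSide_eq {a : ι → ℝ} (ha : ∀ i, 1 < a i) (t : ℕ) (i : ι) :
    cellSide a t i = a i * cellSide a (t + 1) i := by
  have := ha i
  have h0 : a i ≠ 0 := by positivity
  unfold cellSide
  field_simp
  rw [pow_succ]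

lemma succ_le_of_mem_labels [Fintype ι] {a : ι → ℝ} (ha : ∀ i, 1 < a i) {k : ι → ℕ}
    (hk : k ∈ labels a) (i : ι) : (k i : ℝ) + 1 ≤ a i := by
  have h := mem_labels.1 hk i
  have h1 : ((k i + 1 : ℕ) : ℝ) ≤ ⌊a i⌋₊ := by exact_mod_cast h
  have h2 := Nat.floor_le (zero_le_one.trans (ha i).le)
  push_cast at h1
  linarith

section Branch

variable {N : ℕ} {a : ι → ℝ} {e : ℕ → (ι → ℝ) → Fin N → ι → ℕ}

lemma branchCorner_le_succ (ha : ∀ i, 1 < a i) (ω : ℕ → Fin N) (t : ℕ) (i : ι) :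
    branchCorner a e ω t i ≤ branchCorner a e ω (t + 1) i := by
  have := cellSide_pos ha (t + 1) i
  simp only [branchCorner, childCorner]
  have : 0 ≤ (e t (branchCorner a e ω t) (ω t) i : ℝ) * cellSide a (t + 1) i := by positivity
  linarith

/-- Only the first `t` choices matter. Local constancy on the compact space of branches yields both
measurability and finiteness of the set of corners. -/
lemma isLocallyConstant_branchCorner (t : ℕ) :
    IsLocallyConstant fun ω : ℕ → Fin N => branchCorner a e ω t := by
  induction t with
  | zero => exact IsLocallyConstant.const _
  | succ t ih =>
    have h : IsLocallyConstant fun ω : ℕ → Fin N => ω t :=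
      (IsLocallyConstant.iff_continuous _).2 (continuous_apply t)
    exact (ih.prodMk h).comp fun p => childCorner a t p.1 (e t p.1 p.2)

variable [Fintype ι]

lemma branchCorner_succ_add_le (ha : ∀ i, 1 < a i) (he : ∀ t c x, e t c x ∈ labels a)
    (ω : ℕ → Fin N) (t : ℕ) (i : ι) :
    branchCorner a e ω (t + 1) i + cellSide a (t + 1) i ≤
      branchCorner a e ω t i + cellSide a t i := by
  have h1 := cellSide_pos ha (t + 1) i
  have h2 := succ_le_of_mem_labels ha (he t (branchCorner a e ω t) (ω t)) i
  rw [cellSide_eq ha t i]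
  simp only [branchCorner, childCorner]
  nlinarith

lemma branchPoint_mem_cell (ha : ∀ i, 1 < a i) (he : ∀ t c x, e t c x ∈ labels a)
    (ω : ℕ → Fin N) (t : ℕ) : branchPoint a e ω ∈ cell a t (branchCorner a e ω t) := by
  have key : ∀ i, branchPoint a e ω i ∈
      ⋂ t, Icc (branchCorner a e ω t i) (branchCorner a e ω t i + cellSide a t i) := fun i =>
    Monotone.ciSup_mem_iInter_Icc_of_antitone
      (monotone_nat_of_le_succ fun t => branchCorner_le_succ ha ω t i)
      (antitone_nat_of_succ_le fun t => branchCorner_succ_add_le ha he ω t i)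
      (fun t => by have := cellSide_pos ha t i; simp only; linarith)
  exact ⟨fun i => (mem_iInter.1 (key i) t).1, fun i => (mem_iInter.1 (key i) t).2⟩

/-- Half-open boxes are essential here: distinct closed boxes of one level may share a face. -/
lemma branch_eq_of_common_point (ha : ∀ i, 1 < a i) (he : ∀ t c x, e t c x ∈ labels a)
    (hinj : ∀ t c, Function.Injective (e t c)) (ω ω' : ℕ → Fin N) (z : ι → ℝ) (t : ℕ)
    (h : ∀ i, z i ∈ Ico (branchCorner a e ω t i) (branchCorner a e ω t i + cellSide a t i))
    (h' : ∀ i, z i ∈ Ico (branchCorner a e ω' t i) (branchCorner a e ω' t i + cellSide a t i)) :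
    (∀ m < t, ω m = ω' m) ∧ branchCorner a e ω t = branchCorner a e ω' t := by
  induction t with
  | zero => simp [branchCorner]
  | succ t ih =>
    obtain ⟨h1, h2⟩ := ih
      (fun i => ⟨(branchCorner_le_succ ha ω t i).trans (h i).1,
        (h i).2.trans_le (branchCorner_succ_add_le ha he ω t i)⟩)
      (fun i => ⟨(branchCorner_le_succ ha ω' t i).trans (h' i).1,
        (h' i).2.trans_le (branchCorner_succ_add_le ha he ω' t i)⟩)
    simp only [branchCorner, childCorner, mem_Ico, ← h2] at h h'
    have hk : e t (branchCorner a e ω t) (ω t) = e t (branchCorner a e ω t) (ω' t) := by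
      ext i
      have hs := cellSide_pos ha (t + 1) i
      have hi := h i
      have hi' := h' i
      set k := e t (branchCorner a e ω t) (ω t) i
      set k' := e t (branchCorner a e ω t) (ω' t) i
      have b1 : (k : ℝ) < k' + 1 := by
        by_contra hcon
        push Not at hcon
        have := mul_le_mul_of_nonneg_right hcon hs.le
        linarith
      have b2 : (k' : ℝ) < k + 1 := by
        by_contra hcon
        push Not at hcon
        have := mul_le_mul_of_nonneg_right hcon hs.le
        linarith
      have b1' : k < k' + 1 := by exact_mod_cast b1
      have b2' : k' < k + 1 := by exact_mod_cast b2
      omega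
    have hω := hinj _ _ hk
    refine ⟨fun m hm => ?_, ?_⟩
    · rcases Nat.lt_succ_iff_lt_or_eq.1 hm with hm | rfl
      · exact h1 m hm
      · exact hω
    · simp only [branchCorner, ← h2, hω]

lemma measurable_branchPoint : Measurable (branchPoint a e) := by
  refine measurable_pi_lambda _ fun i => Measurable.iSup fun t => ?_
  exact (measurable_pi_apply i).comp (isLocallyConstant_branchCorner t).continuous.measurable

/-- The uniform measure on branches. -/
def branchMeasure (N : ℕ) : Measure (ℕ → Fin N) :=
  Measure.infinitePi fun _ => ProbabilityTheory.uniformOn univ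

lemma branchMeasure_branchCorner_le [NeZero N] (ha : ∀ i, 1 < a i)
    (he : ∀ t c x, e t c x ∈ labels a)
    (hinj : ∀ t c, Function.Injective (e t c)) (t : ℕ) (y : ι → ℝ) :
    branchMeasure N {ω | branchCorner a e ω t = y} ≤ ENNReal.ofReal ((N : ℝ)⁻¹ ^ t) := by
  rcases eq_empty_or_nonempty {ω | branchCorner a e ω t = y} with h0 | ⟨ω, hω⟩
  · simp [h0]
  have hsub : {ω | branchCorner a e ω t = y} ⊆
      Set.pi (Finset.range t : Set ℕ) fun m => {ω m} := by
    intro ω' hω' m hm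
    have hz : ∀ i, branchCorner a e ω t i ∈
        Ico (branchCorner a e ω t i) (branchCorner a e ω t i + cellSide a t i) := fun i =>
      ⟨le_rfl, by have := cellSide_pos ha t i; linarith⟩
    have heq : branchCorner a e ω' t = branchCorner a e ω t := hω'.trans hω.symm
    exact ((branch_eq_of_common_point ha he hinj ω ω' _ t hz (by rw [heq]; exact hz)).1 m
      (by simpa using hm)).symm
  refine (measure_mono hsub).trans ?_
  have : IsProbabilityMeasure (ProbabilityTheory.uniformOn (univ : Set (Fin N))) :=
    ProbabilityTheory.isProbabilityMeasure_uniformOn finite_univ univ_nonempty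
  rw [branchMeasure, Measure.infinitePi_pi _ (fun _ _ => measurableSet_singleton _)]
  have hone : ∀ m, ProbabilityTheory.uniformOn (univ : Set (Fin N)) {ω m} =
      ENNReal.ofReal ((N : ℝ)⁻¹) := by
    intro m
    have hN : (0 : ℝ) < N := by exact_mod_cast Nat.pos_of_ne_zero (NeZero.ne N)
    rw [ProbabilityTheory.uniformOn_univ, Measure.count_singleton, Fintype.card_fin,
      ENNReal.ofReal_inv_of_pos hN, ENNReal.ofReal_natCast, one_div]
  simp only [hone, Finset.prod_const, Finset.card_range]
  rw [ENNReal.ofReal_pow (by positivity)]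

/-- Volume comparison: the half-open boxes are disjoint and lie in the cube of side `4 * ρ` about
`x₀`. Only the longest side needs to be at most `ρ`, so the shape of the boxes is irrelevant. -/
lemma card_mul_prod_cellSide_le (ha : ∀ i, 1 < a i) (he : ∀ t c x, e t c x ∈ labels a)
    (hinj : ∀ t c, Function.Injective (e t c)) (t : ℕ) {ρ : ℝ} (hρ : ∀ i, cellSide a t i ≤ ρ)
    (hρ0 : 0 ≤ ρ) (x₀ : ι → ℝ) (S : Finset (ι → ℝ))
    (hS : ∀ y ∈ S, y ∈ range (fun ω => branchCorner a e ω t) ∧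
      ∃ x ∈ cell a t y, ∀ i, |x i - x₀ i| ≤ ρ) :
    (S.card : ℝ) * ∏ i, cellSide a t i ≤ (4 * ρ) ^ Fintype.card ι := by
  have hdisj : PairwiseDisjoint (S : Set (ι → ℝ))
      fun y => Set.pi univ fun i => Ico (y i) (y i + cellSide a t i) := by
    intro y hy y' hy' hne
    refine disjoint_left.2 fun z hz hz' => hne ?_
    obtain ⟨ω, rfl⟩ := (hS y hy).1
    obtain ⟨ω', rfl⟩ := (hS y' hy').1
    exact (branch_eq_of_common_point ha he hinj ω ω' z t (fun i => hz i trivial)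
      (fun i => hz' i trivial)).2
  have hvol := measure_biUnion_finset (μ := volume) hdisj
    (fun y _ => MeasurableSet.univ_pi fun i => measurableSet_Ico)
  have hsub : (⋃ y ∈ S, Set.pi univ fun i => Ico (y i) (y i + cellSide a t i)) ⊆
      Icc (fun i => x₀ i - 2 * ρ) (fun i => x₀ i + 2 * ρ) := by
    intro z hz
    simp only [mem_iUnion] at hz
    obtain ⟨y, hy, hz⟩ := hz
    obtain ⟨x, hx, hxx⟩ := (hS y hy).2
    have hb : ∀ i, x₀ i - 2 * ρ ≤ z i ∧ z i ≤ x₀ i + 2 * ρ := by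
      intro i
      have h1 := hz i trivial
      have h2 := hx.1 i
      have h3 := hx.2 i
      have h4 := abs_le.1 (hxx i)
      have h5 := hρ i
      simp only [Pi.add_apply] at h3
      constructor <;> linarith [h1.1, h1.2, h4.1, h4.2]
    exact ⟨fun i => (hb i).1, fun i => (hb i).2⟩
  have hle := measure_mono (μ := volume) hsub
  rw [hvol, Real.volume_Icc_pi] at hle
  simp only [Real.volume_pi_Ico, add_sub_cancel_left, Finset.sum_const, nsmul_eq_mul] at hle
  rw [← ENNReal.ofReal_prod_of_nonneg (fun i _ => (cellSide_pos ha t i).le),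
    ← ENNReal.ofReal_prod_of_nonneg (fun i _ => by linarith), ← ENNReal.ofReal_natCast,
    ← ENNReal.ofReal_mul (by positivity)] at hle
  have h4 : ∏ i, (x₀ i + 2 * ρ - (x₀ i - 2 * ρ)) = (4 * ρ) ^ Fintype.card ι := by
    rw [← Finset.card_univ, ← Finset.prod_const]
    exact Finset.prod_congr rfl fun i _ => by ring
  rw [h4] at hle
  exact (ENNReal.ofReal_le_ofReal_iff (by positivity)).1 hle

lemma branchMeasure_preimage_le [NeZero N] (ha : ∀ i, 1 < a i) (he : ∀ t c x, e t c x ∈ labels a)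
    (hinj : ∀ t c, Function.Injective (e t c)) (t : ℕ) {ρ : ℝ} (hρ : ∀ i, cellSide a t i ≤ ρ)
    (hρ0 : 0 ≤ ρ) (A : Set (ι → ℝ)) (hA : Metric.ediam A ≤ ENNReal.ofReal ρ) :
    branchMeasure N (branchPoint a e ⁻¹' A) ≤
      ENNReal.ofReal ((4 * ρ) ^ Fintype.card ι * ((∏ i, a i) / N) ^ t) := by
  rcases A.eq_empty_or_nonempty with rfl | ⟨x₀, hx₀⟩
  · simp
  have hfin : (range fun ω : ℕ → Fin N => branchCorner a e ω t).Finite :=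
    (isLocallyConstant_branchCorner t).range_finite
  have hfinS : {y | y ∈ range (fun ω : ℕ → Fin N => branchCorner a e ω t) ∧
      ∃ x ∈ cell a t y, ∀ i, |x i - x₀ i| ≤ ρ}.Finite := hfin.subset fun y hy => hy.1
  set S := hfinS.toFinset with hSdef
  have hcard := card_mul_prod_cellSide_le ha he hinj t hρ hρ0 x₀ S
    (fun y hy => by simpa [hSdef] using hy)
  have hsub : branchPoint a e ⁻¹' A ⊆ ⋃ y ∈ S, {ω | branchCorner a e ω t = y} := by
    intro ω hω
    simp only [mem_iUnion]
    refine ⟨branchCorner a e ω t, ?_, rfl⟩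
    rw [hSdef, Set.Finite.mem_toFinset]
    refine ⟨⟨ω, rfl⟩, branchPoint a e ω, branchPoint_mem_cell ha he ω t, fun i => ?_⟩
    have h1 : edist (branchPoint a e ω) x₀ ≤ ENNReal.ofReal ρ :=
      (Metric.edist_le_ediam_of_mem (mem_preimage.1 hω) hx₀).trans hA
    have h2 : dist (branchPoint a e ω) x₀ ≤ ρ := by
      rw [edist_dist] at h1
      exact (ENNReal.ofReal_le_ofReal_iff hρ0).1 h1
    exact (dist_le_pi_dist (branchPoint a e ω) x₀ i).trans h2
  have hN : (0 : ℝ) < N := by exact_mod_cast Nat.pos_of_ne_zero (NeZero.ne N)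
  have hP : 0 < ∏ i, a i := Finset.prod_pos fun i _ => zero_lt_one.trans (ha i)
  calc branchMeasure N (branchPoint a e ⁻¹' A)
      ≤ ∑ y ∈ S, branchMeasure N {ω | branchCorner a e ω t = y} :=
        (measure_mono hsub).trans (measure_biUnion_finset_le _ _)
    _ ≤ ∑ y ∈ S, ENNReal.ofReal ((N : ℝ)⁻¹ ^ t) :=
        Finset.sum_le_sum fun y _ => branchMeasure_branchCorner_le ha he hinj t y
    _ = ENNReal.ofReal (S.card * (N : ℝ)⁻¹ ^ t) := by
        rw [Finset.sum_const, nsmul_eq_mul, ENNReal.ofReal_mul (by positivity),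
          ENNReal.ofReal_natCast]
    _ ≤ _ := by
        refine ENNReal.ofReal_le_ofReal ?_
        have hQ : ∏ i, cellSide a t i = ((∏ i, a i) ^ t)⁻¹ := by
          simp only [cellSide, Finset.prod_inv_distrib, Finset.prod_pow]
        rw [hQ, ← div_eq_mul_inv, div_le_iff₀ (by positivity)] at hcard
        rw [div_pow, inv_pow, ← div_eq_mul_inv, ← mul_div_assoc]
        gcongr

end Branch

/-- If half of the subboxes of every box avoid the set `bad`, then there is a set of dimension
at least `s` whose points avoid `bad` at every level. -/
theorem exists_dimH_ge_forall_notMem [Fintype ι] {a : ι → ℝ} {β : ℝ} (hβ : 1 < β)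
    (ha : ∀ i, β ≤ a i) {s : ℝ≥0} (hs : 0 < s) (hsn : (s : ℝ) < Fintype.card ι)
    (hlarge : 8 ^ Fintype.card ι * 2 ≤ β ^ ((Fintype.card ι - s : ℝ) / 2))
    (bad : ℕ → (ι → ℝ) → Set (ι → ℝ))
    (hbad : ∀ t c, 2 * {k ∈ (labels a : Set (ι → ℕ)) |
      (cell a (t + 1) (childCorner a t c k) ∩ bad t c).Nonempty}.ncard ≤ (labels a).card) :
    ∃ X : Set (ι → ℝ), s ≤ dimH X ∧
      ∀ x ∈ X, ∀ t, ∃ c, x ∈ cell a t c ∧ x ∉ bad t c := by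
  classical
  have ha1 : ∀ i, 1 < a i := fun i => hβ.trans_le (ha i)
  set L := (labels a).card with hL
  have hLpos : 0 < L := by
    rw [hL, card_labels]
    exact Finset.prod_pos fun i _ => Nat.floor_pos.2 (ha1 i).le
  -- Every box keeps exactly `N` good children, so that the branches form a full `N`-ary tree
  -- carrying a product measure.
  set N := L - L / 2 with hN
  have hNpos : 0 < N := by omega
  have : NeZero N := ⟨hNpos.ne'⟩
  have hgood : ∀ t c, ∃ f : Fin N → ι → ℕ, Function.Injective f ∧ ∀ x, f x ∈ labels a ∧
      ¬ (cell a (t + 1) (childCorner a t c (f x)) ∩ bad t c).Nonempty := by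
    intro t c
    have hb := hbad t c
    have hsplit := Finset.card_filter_add_card_filter_not (s := labels a)
      (fun k => (cell a (t + 1) (childCorner a t c k) ∩ bad t c).Nonempty)
    set G := {k ∈ labels a | ¬ (cell a (t + 1) (childCorner a t c k) ∩ bad t c).Nonempty} with hG
    have hnc : {k ∈ (labels a : Set (ι → ℕ)) |
      (cell a (t + 1) (childCorner a t c k) ∩ bad t c).Nonempty}.ncard =
      {k ∈ labels a | (cell a (t + 1) (childCorner a t c k) ∩ bad t c).Nonempty}.card := by
      rw [← Set.ncard_coe_finset]
      congr 1
      ext k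
      simp
    rw [hnc] at hb
    have hNG : Fintype.card (Fin N) ≤ Fintype.card G := by
      rw [Fintype.card_fin, Fintype.card_coe]
      omega
    obtain ⟨f⟩ := Function.Embedding.nonempty_of_card_le hNG
    exact ⟨fun x => (f x : ι → ℕ), Subtype.val_injective.comp f.injective,
      fun x => Finset.mem_filter.1 (f x).2⟩
  choose e hinj he using hgood
  have hel : ∀ t c x, e t c x ∈ labels a := fun t c x => (he t c x).1
  refine ⟨range (branchPoint a e), ?_, ?_⟩
  swap
  · rintro _ ⟨ω, rfl⟩ t
    refine ⟨branchCorner a e ω t, branchPoint_mem_cell ha1 hel ω t, fun hmem => ?_⟩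
    exact (he t (branchCorner a e ω t) (ω t)).2
      ⟨_, branchPoint_mem_cell ha1 hel ω (t + 1), hmem⟩
  set n := Fintype.card ι with hn
  have hNR : (0 : ℝ) < N := by exact_mod_cast hNpos
  have hQN : (∏ i, a i) / N ≤ 2 ^ n * 2 := by
    have h1 : ∏ i, a i ≤ 2 ^ n * (L : ℝ) := by
      rw [hL, card_labels, hn, ← Finset.card_univ, ← Finset.prod_const, Nat.cast_prod,
        ← Finset.prod_mul_distrib]
      refine Finset.prod_le_prod (fun i _ => (zero_lt_one.trans (ha1 i)).le) fun i _ => ?_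
      have h2 := Nat.lt_floor_add_one (a i)
      have h3 : (1 : ℝ) ≤ ⌊a i⌋₊ := by exact_mod_cast Nat.floor_pos.2 (ha1 i).le
      linarith
    have h2 : (L : ℝ) ≤ 2 * N := by exact_mod_cast (by omega : L ≤ 2 * N)
    rw [div_le_iff₀ hNR]
    nlinarith [pow_pos (two_pos : (0 : ℝ) < 2) n]
  have hQ0 : 0 < ∏ i, a i := Finset.prod_pos fun i _ => zero_lt_one.trans (ha1 i)
  have hβ0 : 0 < β := zero_lt_one.trans hβ
  have hside : ∀ t i, cellSide a t i ≤ (β ^ t)⁻¹ := fun t i => by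
    have := ha i
    unfold cellSide
    gcongr
  -- The loss `(8 ^ n * 2) ^ (m + 2)` is absorbed by `ρ ^ (-(n - s))`. The `1 / 2` in the exponent
  -- of `hlarge` pays for the gap between levels, as `(m + 2) / 2 ≤ m + 1`.
  have hmain : ∀ (m : ℕ) (ρ : ℝ), 0 < ρ → ρ ≤ (β ^ (m + 1))⁻¹ →
      (4 * ρ) ^ n * ((∏ i, a i) / N) ^ (m + 2) ≤ ρ ^ (s : ℝ) := by
    intro m ρ hρ hρ2
    have hd : 0 < (n - s : ℝ) := by linarith
    have h1 : (4 : ℝ) ^ n * ((∏ i, a i) / N) ^ (m + 2) ≤ (8 ^ n * 2) ^ (m + 2) := by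
      have h48 : (8 : ℝ) ^ n * 2 = 4 ^ n * (2 ^ n * 2) := by
        rw [← mul_assoc, ← mul_pow]; norm_num
      rw [h48, mul_pow (4 ^ n)]
      gcongr
      exact le_self_pow₀ (one_le_pow₀ (by norm_num)) (by omega)
    have h2 : ((8 : ℝ) ^ n * 2) ^ (m + 2) ≤ (β ^ (m + 1)) ^ (n - s : ℝ) := by
      refine (pow_le_pow_left₀ (by positivity) hlarge _).trans ?_
      rw [← Real.rpow_natCast (_ ^ _), ← Real.rpow_mul hβ0.le, ← Real.rpow_natCast β,
        ← Real.rpow_mul hβ0.le]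
      refine Real.rpow_le_rpow_of_exponent_le hβ.le ?_
      push_cast
      nlinarith [(Nat.cast_nonneg m : (0 : ℝ) ≤ m)]
    have h3 : (β ^ (m + 1)) ^ (n - s : ℝ) ≤ (ρ⁻¹) ^ (n - s : ℝ) := by
      refine Real.rpow_le_rpow (by positivity) ?_ hd.le
      rwa [le_inv_comm₀ (by positivity) hρ]
    have h4 : ρ ^ n * (ρ⁻¹) ^ (n - s : ℝ) = ρ ^ (s : ℝ) := by
      rw [Real.inv_rpow hρ.le, ← Real.rpow_neg hρ.le, ← Real.rpow_natCast, ← Real.rpow_add hρ]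
      congr 1
      ring
    rw [mul_pow, mul_comm ((4 : ℝ) ^ n), mul_assoc, ← h4]
    gcongr
    exact h1.trans (h2.trans h3)
  set μ := (branchMeasure N).map (branchPoint a e) with hμ
  have : IsProbabilityMeasure (ProbabilityTheory.uniformOn (univ : Set (Fin N))) :=
    ProbabilityTheory.isProbabilityMeasure_uniformOn finite_univ univ_nonempty
  have hle : μ ≤ Measure.hausdorffMeasure (s : ℝ) := by
    refine Measure.le_hausdorffMeasure _ _ (ENNReal.ofReal β⁻¹) (by simpa using hβ0) ?_
    intro A hA
    -- `A` need not be measurable; its closure is, and has the same diameter.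
    have hcl : μ A ≤ branchMeasure N (branchPoint a e ⁻¹' closure A) := by
      rw [← Measure.map_apply measurable_branchPoint isClosed_closure.measurableSet]
      exact measure_mono subset_closure
    have hcd : Metric.ediam (closure A) = Metric.ediam A := Metric.ediam_closure A
    have hbound : ∀ (m : ℕ) (ρ : ℝ), 0 < ρ → (β ^ (m + 2))⁻¹ ≤ ρ → ρ ≤ (β ^ (m + 1))⁻¹ →
        Metric.ediam A ≤ ENNReal.ofReal ρ → μ A ≤ ENNReal.ofReal (ρ ^ (s : ℝ)) := by
      intro m ρ hρ h1 h2 h3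
      refine hcl.trans ((branchMeasure_preimage_le ha1 hel hinj (m + 2)
        (fun i => (hside _ i).trans h1) hρ.le _ (hcd ▸ h3)).trans ?_)
      exact ENNReal.ofReal_le_ofReal (hmain m ρ hρ h2)
    -- A set of diameter zero has no scale of its own; the bound is applied at every scale `β ^ (-(m
    -- + 1))` and passed to the limit.
    rcases eq_or_ne (Metric.ediam A) 0 with h0 | h0
    · rw [h0, ENNReal.zero_rpow_of_pos (by exact_mod_cast hs)]
      have hlim : Filter.Tendsto
          (fun m : ℕ => ENNReal.ofReal (((β⁻¹) ^ (s : ℝ)) ^ (m + 1))) Filter.atTop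
          (nhds 0) := by
        rw [← ENNReal.ofReal_zero]
        refine ENNReal.tendsto_ofReal ((Filter.tendsto_add_atTop_iff_nat 1).2 ?_)
        exact tendsto_pow_atTop_nhds_zero_of_lt_one (by positivity)
          (Real.rpow_lt_one (by positivity) (inv_lt_one_of_one_lt₀ hβ) (by exact_mod_cast hs))
      refine ge_of_tendsto' hlim fun m => ?_
      refine (hbound m ((β ^ (m + 1))⁻¹) (by positivity) ?_ le_rfl (by simp [h0])).trans_eq ?_
      · gcongr
        · exact hβ.le
        · omega
      · congr 1
        rw [← inv_pow, ← Real.rpow_natCast, ← Real.rpow_natCast, ← Real.rpow_mul (by positivity),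
          ← Real.rpow_mul (by positivity), mul_comm]
    · have hfinA : Metric.ediam A ≠ ⊤ := (hA.trans_lt ENNReal.ofReal_lt_top).ne
      set r := (Metric.ediam A).toReal with hr
      have hr0 : 0 < r := ENNReal.toReal_pos h0 hfinA
      have hAr : Metric.ediam A = ENNReal.ofReal r := (ENNReal.ofReal_toReal hfinA).symm
      have hr1 : r ≤ β⁻¹ := by
        rw [hAr] at hA
        exact (ENNReal.ofReal_le_ofReal_iff (by positivity)).1 hA
      obtain ⟨m, hm1, hm2⟩ := exists_nat_pow_near (x := r⁻¹ / β) (y := β)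
        (by rw [le_div_iff₀ hβ0, one_mul]; exact (le_inv_comm₀ hr0 hβ0).1 hr1) hβ
      rw [le_div_iff₀ hβ0, ← pow_succ] at hm1
      rw [div_lt_iff₀ hβ0, ← pow_succ] at hm2
      rw [hAr, ENNReal.ofReal_rpow_of_pos hr0]
      exact hbound m r hr0 ((inv_le_comm₀ (by positivity) hr0).2 hm2.le)
        ((le_inv_comm₀ (by positivity) hr0).1 hm1) hAr.le
  refine le_dimH_of_hausdorffMeasure_ne_zero fun h0 => ?_
  have h1 : (1 : ℝ≥0∞) ≤ μ (range (branchPoint a e)) := by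
    refine le_trans ?_ (Measure.le_map_apply measurable_branchPoint.aemeasurable _)
    rw [preimage_range, branchMeasure, measure_univ]
  have h2 := hle (range (branchPoint a e))
  rw [h0] at h2
  exact absurd (h1.trans h2) (by simp)

end Cantor

/-! ### Few subboxes meet a thin slab -/

noncomputable section Slab

open Set

variable {ι : Type*} [Fintype ι]

lemma card_le_of_forall_sub_le (S : Finset ℕ) {L : ℝ} (hL : 0 ≤ L)
    (h : ∀ k ∈ S, ∀ k' ∈ S, (k : ℝ) - k' ≤ L) : (S.card : ℝ) ≤ L + 1 := by
  rcases S.eq_empty_or_nonempty with rfl | hne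
  · simp only [Finset.card_empty, Nat.cast_zero]
    linarith
  have hsub : S ⊆ Finset.Icc (S.min' hne) (S.max' hne) := fun k hk =>
    Finset.mem_Icc.2 ⟨S.min'_le k hk, S.le_max' k hk⟩
  have h1 := Finset.card_le_card hsub
  rw [Nat.card_Icc] at h1
  have h2 := h _ (S.max'_mem hne) _ (S.min'_mem hne)
  have h3 : S.min' hne ≤ S.max' hne := S.min'_le_max' hne
  have h4 : ((S.card + S.min' hne : ℕ) : ℝ) ≤ (S.max' hne + 1 : ℕ) := by exact_mod_cast (by omega)
  push_cast at h4
  linarith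

/-- In the direction `i₀`, where the form varies most over the box, a thin slab is crossed quickly:
once the other labels are fixed, the label in direction `i₀` is confined to a short interval. -/
lemma ncard_labels_meeting_slab_le {a : ι → ℝ}
    (ha : ∀ i, 8 * (Fintype.card ι + 1 : ℝ) * (2 * Fintype.card ι + 1) ≤ a i) (t : ℕ)
    (c v : ι → ℝ) (b δ : ℝ) (i₀ : ι) (hv : v i₀ ≠ 0)
    (hδ : δ ≤ |v i₀| * cellSide a t i₀ / (16 * (Fintype.card ι + 1)))
    (hmax : ∀ i, |v i| * cellSide a t i ≤ |v i₀| * cellSide a t i₀) :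
    2 * (Fintype.card ι + 1) * {k ∈ (labels a : Set (ι → ℕ)) |
      (cell a (t + 1) (childCorner a t c k) ∩ {x | |∑ i, v i * x i - b| < δ}).Nonempty}.ncard ≤
        (labels a).card := by
  classical
  set n := Fintype.card ι with hn
  set D := 8 * (n + 1 : ℝ) * (2 * n + 1) with hD
  have hn0 : (0 : ℝ) ≤ n := Nat.cast_nonneg n
  have hD1 : 1 < D := by rw [hD]; nlinarith
  have hD0 : 0 < D := zero_lt_one.trans hD1
  have ha1 : ∀ i, 1 < a i := fun i => hD1.trans_le (ha i)
  have hnc : {k ∈ (labels a : Set (ι → ℕ)) |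
      (cell a (t + 1) (childCorner a t c k) ∩ {x | |∑ i, v i * x i - b| < δ}).Nonempty} =
      ({k ∈ labels a | (cell a (t + 1) (childCorner a t c k) ∩
        {x | |∑ i, v i * x i - b| < δ}).Nonempty} : Finset (ι → ℕ)) := by
    ext k
    simp
  rw [hnc, Set.ncard_coe_finset]
  set B : Finset (ι → ℕ) := {k ∈ labels a | (cell a (t + 1) (childCorner a t c k) ∩
        {x | |∑ i, v i * x i - b| < δ}).Nonempty} with hB
  have hsp : ∀ i, 0 < cellSide a (t + 1) i := cellSide_pos ha1 (t + 1)
  set W := |v i₀| * cellSide a t i₀ with hW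
  have hWpos : 0 < W := mul_pos (abs_pos.2 hv) (cellSide_pos ha1 t i₀)
  have hchild : ∀ k ∈ B, |∑ i, v i * childCorner a t c k i - b| ≤
      W * (1 / (16 * (n + 1)) + n / D) := by
    intro k hk
    obtain ⟨x, hx, hxs⟩ := (Finset.mem_filter.1 hk).2
    have h1 : |∑ i, v i * childCorner a t c k i - ∑ i, v i * x i| ≤ n * (W / D) := by
      rw [← Finset.sum_sub_distrib, hn, ← Finset.card_univ, ← nsmul_eq_mul]
      refine (Finset.abs_sum_le_sum_abs _ _).trans (Finset.sum_le_card_nsmul _ _ _ fun i _ => ?_)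
      have h2 : |childCorner a t c k i - x i| ≤ cellSide a (t + 1) i := by
        have h3 := hx.1 i
        have h4 := hx.2 i
        simp only [Pi.add_apply] at h4
        rw [abs_le]
        constructor <;> linarith [hsp i]
      rw [← mul_sub, abs_mul]
      refine (mul_le_mul_of_nonneg_left h2 (abs_nonneg _)).trans ?_
      rw [le_div_iff₀ (by linarith)]
      refine le_trans ?_ (hmax i)
      rw [cellSide_eq ha1 t i, mul_comm (a i), mul_assoc]
      refine mul_le_mul_of_nonneg_left ?_ (abs_nonneg _)
      exact mul_le_mul_of_nonneg_left (ha i) (hsp i).le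
    have h5 : |∑ i, v i * x i - b| < δ := hxs
    have h6 := abs_sub_le (∑ i, v i * childCorner a t c k i) (∑ i, v i * x i) b
    calc _ ≤ n * (W / D) + W / (16 * (n + 1)) := by linarith
      _ = _ := by ring
  set L := a i₀ * (2 * (1 / (16 * (n + 1)) + n / D)) with hL
  have hL0 : 0 ≤ L := by
    have h1 : 0 < a i₀ := zero_lt_one.trans (ha1 i₀)
    have h2 : 0 ≤ n / D := div_nonneg hn0 hD0.le
    rw [hL]
    positivity
  have hfiber : ∀ k ∈ B, ∀ k' ∈ B, Function.update k i₀ 0 = Function.update k' i₀ 0 →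
      (k i₀ : ℝ) - k' i₀ ≤ L := by
    intro k hk k' hk' heq
    have hother : ∀ i, i ≠ i₀ → k i = k' i := fun i hi => by
      simpa [hi] using congrFun heq i
    have hdiff : ∑ i, v i * childCorner a t c k i - ∑ i, v i * childCorner a t c k' i =
        v i₀ * ((k i₀ - k' i₀) * cellSide a (t + 1) i₀) := by
      rw [← Finset.sum_sub_distrib, Finset.sum_eq_single i₀]
      · simp only [childCorner]
        ring
      · intro i _ hi
        simp only [childCorner, hother i hi]
        ring
      · simp
    have h1 := hchild k hk
    have h2 := hchild k' hk'
    have h3 : |v i₀ * ((k i₀ - k' i₀) * cellSide a (t + 1) i₀)| ≤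
        2 * (W * (1 / (16 * (n + 1)) + n / D)) := by
      rw [← hdiff, abs_le]
      rw [abs_le] at h1 h2
      constructor <;> linarith [h1.1, h1.2, h2.1, h2.2]
    rw [abs_mul, abs_mul, abs_of_pos (hsp i₀), hW, cellSide_eq ha1 t i₀] at h3
    have hp : 0 < |v i₀| * cellSide a (t + 1) i₀ := mul_pos (abs_pos.2 hv) (hsp i₀)
    have h4 : (|v i₀| * cellSide a (t + 1) i₀) * |(k i₀ : ℝ) - k' i₀| ≤
        (|v i₀| * cellSide a (t + 1) i₀) * L := by
      rw [hL]
      linarith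
    exact (le_abs_self _).trans (le_of_mul_le_mul_left h4 hp)
  -- The constants `16 * (n + 1)` and `D` are tuned so that the width of the slab contributes `a i₀
  -- / 4`, and the size of the subboxes together with the `+ 1` at most another `a i₀ / 4`. Finally
  -- `a i₀ / 2 ≤ ⌊a i₀⌋₊`.
  have hLle : 2 * (n + 1 : ℝ) * (L + 1) ≤ ⌊a i₀⌋₊ := by
    have h1 : (1 : ℝ) ≤ ⌊a i₀⌋₊ := by exact_mod_cast Nat.floor_pos.2 (ha1 i₀).le
    have h2 := Nat.lt_floor_add_one (a i₀)
    have h3 : 2 * (n + 1 : ℝ) * (L + 1) = a i₀ / 4 + (a i₀ * n / (2 * (2 * n + 1)) + 2 * (n + 1)) := by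
      rw [hL, hD]
      field_simp
      ring
    have h4 : a i₀ * n / (2 * (2 * n + 1)) + 2 * (n + 1) ≤ a i₀ / 4 := by
      have h5 := ha i₀
      rw [hD] at h5
      have h6 : 2 * (n + 1) ≤ a i₀ / (4 * (2 * n + 1)) := by
        rw [le_div_iff₀ (by positivity)]
        linarith
      have h7 : a i₀ * n / (2 * (2 * n + 1)) + a i₀ / (4 * (2 * n + 1)) = a i₀ / 4 := by
        field_simp
        ring
      linarith
    linarith
  set K := ⌊L + 1⌋₊ with hK
  have hcard : B.card ≤ K * (B.image fun k => Function.update k i₀ 0).card := by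
    refine Finset.card_le_mul_card_image _ _ fun u _ => ?_
    set F := {k ∈ B | Function.update k i₀ 0 = u} with hF
    have hinj : InjOn (fun k : ι → ℕ => k i₀) F := by
      intro k hk k' hk' heq
      have h1 := (Finset.mem_filter.1 hk).2.trans (Finset.mem_filter.1 hk').2.symm
      ext i
      by_cases hi : i = i₀
      · subst hi; exact heq
      · simpa [hi] using congrFun h1 i
    rw [← Finset.card_image_of_injOn hinj, hK]
    refine Nat.le_floor (card_le_of_forall_sub_le _ hL0 ?_)
    intro x hx x' hx'
    obtain ⟨k, hk, rfl⟩ := Finset.mem_image.1 hx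
    obtain ⟨k', hk', rfl⟩ := Finset.mem_image.1 hx'
    obtain ⟨hk1, hk2⟩ := Finset.mem_filter.1 hk
    obtain ⟨hk1', hk2'⟩ := Finset.mem_filter.1 hk'
    exact hfiber k hk1 k' hk1' (hk2.trans hk2'.symm)
  set P := ∏ i ∈ Finset.univ \ {i₀}, ⌊a i⌋₊ with hP
  have himage : (B.image fun k => Function.update k i₀ 0).card ≤ P := by
    have hsub : (B.image fun k => Function.update k i₀ 0) ⊆
        Fintype.piFinset (fun i => Finset.range (Function.update (fun i => ⌊a i⌋₊) i₀ 1 i)) := by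
      intro u hu
      obtain ⟨k, hk, rfl⟩ := Finset.mem_image.1 hu
      rw [Fintype.mem_piFinset]
      intro i
      by_cases hi : i = i₀
      · subst hi; simp
      · simpa [hi] using mem_labels.1 (Finset.mem_filter.1 hk).1 i
    refine (Finset.card_le_card hsub).trans_eq ?_
    rw [Fintype.card_piFinset]
    simp only [Finset.card_range]
    rw [Finset.prod_update_of_mem (Finset.mem_univ _), one_mul]
  have hlab : (labels a).card = ⌊a i₀⌋₊ * P := by
    rw [card_labels, hP, Finset.prod_eq_mul_prod_sdiff_singleton_of_mem (Finset.mem_univ i₀)]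
  have hKle : 2 * (n + 1) * K ≤ ⌊a i₀⌋₊ := by
    have h1 : (K : ℝ) ≤ L + 1 := Nat.floor_le (by linarith)
    have h2 : ((2 * (n + 1) * K : ℕ) : ℝ) ≤ ⌊a i₀⌋₊ := by
      push_cast
      exact (mul_le_mul_of_nonneg_left h1 (by positivity)).trans hLle
    exact_mod_cast h2
  calc 2 * (n + 1) * B.card ≤ 2 * (n + 1) * (K * P) := by
        gcongr
        exact hcard.trans (Nat.mul_le_mul_left _ himage)
    _ = (2 * (n + 1) * K) * P := by ring
    _ ≤ ⌊a i₀⌋₊ * P := Nat.mul_le_mul_right _ hKle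
    _ = _ := hlab.symm

end Slab

/-! ### Best approximations of a linear form -/

section BestApproximation

open Finset

variable {ι : Type*} [Fintype ι]

lemma distNearestInt_le (x : ℝ) (z : ℤ) : distNearestInt x ≤ |x - z| := round_le x z

/-- Dirichlet's pigeonhole argument with `⌊∏ A i⌋₊` holes; the `2` pays for the floor. -/
lemma exists_int_vector_distNearestInt_le [Nonempty ι] (θ A : ι → ℝ) (hA : ∀ i, 1 ≤ A i) :
    ∃ v : ι → ℤ, v ≠ 0 ∧ (∀ i, |(v i : ℝ)| ≤ A i) ∧
      distNearestInt (∑ i, v i * θ i) ≤ 2 / ∏ i, A i := by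
  classical
  set Q := ∏ i, A i with hQ
  have hQ1 : 1 ≤ Q := by
    simpa using Finset.prod_le_prod (s := univ) (f := fun _ => (1 : ℝ))
      (fun _ _ => zero_le_one) fun i _ => hA i
  set P := ⌊Q⌋₊ with hP
  have hP1 : 1 ≤ P := Nat.floor_pos.2 hQ1
  have hPR : (1 : ℝ) ≤ P := by exact_mod_cast hP1
  have hPQ : Q ≤ 2 * P := by
    have := Nat.lt_floor_add_one Q
    linarith
  set T : Finset (ι → ℕ) := Fintype.piFinset fun i => range (⌊A i⌋₊ + 1) with hT
  have hcard : P < T.card := by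
    rw [hT, Fintype.card_piFinset]
    simp only [card_range]
    have h1 : Q < ∏ i, ((⌊A i⌋₊ + 1 : ℕ) : ℝ) := by
      refine Finset.prod_lt_prod_of_nonempty (fun i _ => zero_lt_one.trans_le (hA i))
        (fun i _ => ?_) univ_nonempty
      push_cast
      exact Nat.lt_floor_add_one _
    have h2 : (P : ℝ) < ((∏ i, (⌊A i⌋₊ + 1) : ℕ) : ℝ) := by
      rw [Nat.cast_prod]
      exact (Nat.floor_le (by linarith)).trans_lt h1
    exact_mod_cast h2
  set f : (ι → ℕ) → ℕ := fun u => ⌊Int.fract (∑ i, (u i : ℝ) * θ i) * P⌋₊ with hf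
  have hmaps : ∀ u ∈ T, f u ∈ range P := by
    intro u _
    rw [Finset.mem_range, hf, Nat.floor_lt (mul_nonneg (Int.fract_nonneg _) (by linarith))]
    have := Int.fract_lt_one (∑ i, (u i : ℝ) * θ i)
    nlinarith
  obtain ⟨u, hu, w, hw, hne, heq⟩ :=
    exists_ne_map_eq_of_card_lt_of_maps_to (by simpa using hcard) hmaps
  have hbound : ∀ u ∈ T, ∀ i, (u i : ℝ) ≤ A i := fun u hu i => by
    have h1 : u i ≤ ⌊A i⌋₊ := by
      have := Finset.mem_range.1 (Fintype.mem_piFinset.1 hu i)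
      omega
    exact (Nat.le_floor_iff (by linarith [hA i])).1 h1
  refine ⟨fun i => (u i : ℤ) - w i, fun h => hne ?_, fun i => ?_, ?_⟩
  · ext i
    have := congrFun h i
    simp only [Pi.zero_apply] at this
    omega
  · have h1 := hbound u hu i
    have h2 := hbound w hw i
    have h3 : (0 : ℝ) ≤ u i := Nat.cast_nonneg _
    have h4 : (0 : ℝ) ≤ w i := Nat.cast_nonneg _
    push_cast
    rw [abs_le]
    constructor <;> linarith
  · set X := ∑ i, (u i : ℝ) * θ i with hX
    set Y := ∑ i, (w i : ℝ) * θ i with hY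
    have hsum : ∑ i, (((u i : ℤ) - w i : ℤ) : ℝ) * θ i = X - Y := by
      rw [hX, hY, ← Finset.sum_sub_distrib]
      refine Finset.sum_congr rfl fun i _ => ?_
      push_cast
      ring
    rw [hsum]
    refine (distNearestInt_le _ (⌊X⌋ - ⌊Y⌋)).trans ?_
    have h1 : X - Y - ((⌊X⌋ - ⌊Y⌋ : ℤ) : ℝ) = Int.fract X - Int.fract Y := by
      simp only [Int.fract]
      push_cast
      ring
    have hx0 := mul_nonneg (Int.fract_nonneg X) (Nat.cast_nonneg (α := ℝ) P)
    have hy0 := mul_nonneg (Int.fract_nonneg Y) (Nat.cast_nonneg (α := ℝ) P)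
    have hx1 := Nat.floor_le hx0
    have hx2 := Nat.lt_floor_add_one (Int.fract X * P)
    have hy1 := Nat.floor_le hy0
    have hy2 := Nat.lt_floor_add_one (Int.fract Y * P)
    have heq' : (⌊Int.fract X * P⌋₊ : ℝ) = ⌊Int.fract Y * P⌋₊ := by exact_mod_cast heq
    have h2 : |(Int.fract X - Int.fract Y) * P| ≤ 1 := by
      rw [abs_le]
      constructor <;> nlinarith
    rw [abs_mul, Nat.abs_cast] at h2
    rw [h1, le_div_iff₀ (by linarith)]
    nlinarith [abs_nonneg (Int.fract X - Int.fract Y)]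

/-- A sequence of integer vectors `v m` in boxes of size `a ^ m`, such that the values of the
linear form `θ` are as small as Dirichlet's theorem permits along those `v m` that do not already
lie well inside the previous box. -/
theorem exists_bestApproximations [Nonempty ι] (θ a : ι → ℝ) (ha : ∀ i, 1 ≤ a i) :
    ∃ v : ℕ → ι → ℤ, (∀ m i, |(v m i : ℝ)| ≤ a i ^ m) ∧
      ∀ m, ∃ m₀ ≤ m, (∃ i, a i ^ m₀ ≤ a i * |(v m₀ i : ℝ)|) ∧
        distNearestInt (∑ i, v m₀ i * θ i) ≤ 2 / (∏ i, a i) ^ m := by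
  classical
  set box : ℕ → Set (ι → ℤ) := fun m => {v | v ≠ 0 ∧ ∀ i, |(v i : ℝ)| ≤ a i ^ m} with hbox
  have hfin : ∀ m, (box m).Finite := by
    intro m
    refine (Set.finite_Icc (fun i => -⌊a i ^ m⌋) (fun i => ⌊a i ^ m⌋)).subset fun v hv => ?_
    have h1 : ∀ i, |v i| ≤ ⌊a i ^ m⌋ := fun i => Int.le_floor.2 (by
      push_cast
      exact hv.2 i)
    exact ⟨fun i => (abs_le.1 (h1 i)).1, fun i => (abs_le.1 (h1 i)).2⟩
  have hdir := fun m => exists_int_vector_distNearestInt_le θ (fun i => a i ^ m)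
    fun i => one_le_pow₀ (ha i)
  have hmin : ∀ m, ∃ v ∈ box m, ∀ w ∈ box m,
      distNearestInt (∑ i, v i * θ i) ≤ distNearestInt (∑ i, w i * θ i) := fun m =>
    Set.exists_min_image _ _ (hfin m) (by
      obtain ⟨v, h1, h2, _⟩ := hdir m
      exact ⟨v, h1, h2⟩)
  choose v hv hvmin using hmin
  refine ⟨v, fun m => (hv m).2, fun m => ?_⟩
  set d : ℕ → ℝ := fun m => distNearestInt (∑ i, v m i * θ i) with hd
  have hex : ∃ k, d k = d m := ⟨m, rfl⟩
  -- The first index attaining the minimal value `d m`. Were `v m₀` well inside the previous box,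
  -- that value would already be attained there.
  set m₀ := Nat.find hex with hm₀
  have hm₀d : d m₀ = d m := Nat.find_spec hex
  have hm₀m : m₀ ≤ m := Nat.find_min' hex rfl
  refine ⟨m₀, hm₀m, ?_, ?_⟩
  · by_contra! hcon
    have hpos : 0 < m₀ := by
      rw [Nat.pos_iff_ne_zero]
      intro h0
      refine (hv m₀).1 (funext fun i => ?_)
      have h1 := (hv m₀).2 i
      have h2 := hcon i
      rw [h0, pow_zero] at h2
      by_contra hne
      have h3 : (1 : ℝ) ≤ |(v m₀ i : ℝ)| := by
        exact_mod_cast Int.one_le_abs hne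
      rw [h0] at h3
      nlinarith [ha i]
    obtain ⟨k, hk⟩ := Nat.exists_eq_succ_of_ne_zero hpos.ne'
    have hin : v m₀ ∈ box k := by
      refine ⟨(hv m₀).1, fun i => ?_⟩
      have h1 := hcon i
      rw [hk, pow_succ, mul_comm] at h1
      rw [hk]
      exact (lt_of_mul_lt_mul_right h1 (by linarith [ha i])).le
    have h1 : d k ≤ d m₀ := hvmin k _ hin
    have h2 : d m ≤ d k := hvmin m _ ⟨(hv k).1, fun i => ((hv k).2 i).trans
      (pow_le_pow_right₀ (ha i) (by omega))⟩
    exact Nat.find_min hex (m := k) (by omega) (by linarith)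
  · obtain ⟨w, h1, h2, h3⟩ := hdir m
    rw [Finset.prod_pow] at h3
    change d m₀ ≤ _
    rw [hm₀d]
    exact (hvmin m w ⟨h1, h2⟩).trans h3

end BestApproximation

/-! ### The obstacles and the dimension -/

noncomputable section Obstacles

open Set
open scoped ENNReal NNReal

variable {ι : Type*} [Fintype ι]

lemma ncard_labels_meeting_le_of_subset_slab [DecidableEq ι] {a : ι → ℝ}
    (ha : ∀ i, 8 * (Fintype.card ι + 1 : ℝ) * (2 * Fintype.card ι + 1) ≤ a i) (t : ℕ)
    (c v : ι → ℝ) (b δ : ℝ) (i₀ : ι) (hv : v i₀ ≠ 0)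
    (hδ : δ ≤ |v i₀| * cellSide a t i₀ / (16 * (Fintype.card ι + 1)))
    (hmax : ∀ i, |v i| * cellSide a t i ≤ |v i₀| * cellSide a t i₀) {B : Set (ι → ℝ)}
    (hB : B ⊆ {x | |∑ i, v i * x i - b| < δ}) :
    2 * (Fintype.card ι + 1) * {k ∈ (labels a : Set (ι → ℕ)) |
      (cell a (t + 1) (childCorner a t c k) ∩ B).Nonempty}.ncard ≤ (labels a).card := by
  refine le_trans (Nat.mul_le_mul_left _ (Set.ncard_le_ncard ?_ ?_))
    (ncard_labels_meeting_slab_le ha t c v b δ i₀ hv hδ hmax)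
  · exact fun k hk => ⟨hk.1, hk.2.mono (inter_subset_inter_right _ hB)⟩
  · exact (labels a).finite_toSet.subset fun k hk => hk.1

lemma abs_sum_mul_sub_le_of_mem_cell {a : ι → ℝ} {t : ℕ} {c x y : ι → ℝ} (hx : x ∈ cell a t c)
    (hy : y ∈ cell a t c) (v : ι → ℝ) :
    |∑ i, v i * x i - ∑ i, v i * y i| ≤ ∑ i, |v i| * cellSide a t i := by
  rw [← Finset.sum_sub_distrib]
  refine (Finset.abs_sum_le_sum_abs _ _).trans (Finset.sum_le_sum fun i _ => ?_)
  rw [← mul_sub, abs_mul]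
  refine mul_le_mul_of_nonneg_left ?_ (abs_nonneg _)
  have h1 := hx.1 i
  have h2 := hx.2 i
  have h3 := hy.1 i
  have h4 := hy.2 i
  simp only [Pi.add_apply] at h2 h4
  rw [abs_le]
  constructor <;> linarith

/-- The points of a box of level `t` that are too close to a rational number in coordinate `i`. -/
def rationalObstacle (a : ι → ℝ) (ε : ℝ) (t : ℕ) (c : ι → ℝ) (i : ι) : Set (ι → ℝ) :=
  {x | x ∈ cell a t c ∧ ∃ (p : ℤ) (q : ℕ), 0 < q ∧ a i ^ t ≤ 2 * q ^ 2 * a i ∧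
    2 * (q : ℝ) ^ 2 < a i ^ t ∧ |x i - p / q| < ε * cellSide a t i}

/-- The points of a box of level `t` at which the integer linear form `v m`, `t = m + 1`, is too
close to an integer. -/
def linearObstacle (a : ι → ℝ) (v : ℕ → ι → ℤ) (δ : ℝ) (t : ℕ) (c : ι → ℝ) : Set (ι → ℝ) :=
  {x | x ∈ cell a t c ∧ ∃ m, t = m + 1 ∧ (∃ i, a i ^ m ≤ a i * |(v m i : ℝ)|) ∧
    ∃ b : ℤ, |∑ i, v m i * x i - b| < δ}

/-- Distinct fractions whose denominators satisfy `2 * q ^ 2 < a i ^ t` are more than two sides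
apart, so a single fraction, hence a single slab, is relevant to the box. -/
lemma ncard_labels_meeting_rationalObstacle_le {a : ι → ℝ}
    (ha : ∀ i, 8 * (Fintype.card ι + 1 : ℝ) * (2 * Fintype.card ι + 1) ≤ a i) (t : ℕ)
    (c : ι → ℝ) (i : ι) {ε : ℝ} (hε : ε ≤ 1 / (16 * (Fintype.card ι + 1))) :
    2 * (Fintype.card ι + 1) * {k ∈ (labels a : Set (ι → ℕ)) |
      (cell a (t + 1) (childCorner a t c k) ∩ rationalObstacle a ε t c i).Nonempty}.ncard ≤
        (labels a).card := by
  classical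
  rcases (rationalObstacle a ε t c i).eq_empty_or_nonempty with
    h0 | ⟨x₀, hx₀, p₀, q₀, hq₀, -, hq₀t, hpq₀⟩
  · simp [h0]
  have hn0 : (0 : ℝ) ≤ Fintype.card ι := Nat.cast_nonneg _
  have ha1 : ∀ i, 1 < a i := fun i => lt_of_lt_of_le (by nlinarith) (ha i)
  have hs := cellSide_pos ha1 t i
  refine ncard_labels_meeting_le_of_subset_slab ha t c (Pi.single i 1) (p₀ / q₀)
    (ε * cellSide a t i) i (by simp) ?_ ?_ ?_
  · have := mul_le_mul_of_nonneg_right hε hs.le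
    simpa [div_eq_inv_mul] using this
  · intro i'
    by_cases h : i' = i
    · subst h; rfl
    · simpa [h] using hs.le
  · rintro x ⟨hx, p, q, hq, -, hqt, hpq⟩
    have hε1 : ε ≤ 1 / 16 := hε.trans (by gcongr; linarith)
    have hsum : ∑ i', (Pi.single i 1 : ι → ℝ) i' * x i' = x i := by
      simp [Pi.single_apply]
    rw [mem_ofPred_eq, hsum]
    suffices h : (p : ℝ) / q = p₀ / q₀ by rwa [← h]
    have hqR : (0 : ℝ) < q := by exact_mod_cast hq
    have hq₀R : (0 : ℝ) < q₀ := by exact_mod_cast hq₀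
    have hdist : |(p : ℝ) / q - p₀ / q₀| < 2 * cellSide a t i := by
      have h1 := hx.1 i
      have h2 := hx.2 i
      have h3 := hx₀.1 i
      have h4 := hx₀.2 i
      simp only [Pi.add_apply] at h2 h4
      rw [abs_lt] at hpq hpq₀ ⊢
      constructor <;> nlinarith [hpq.1, hpq.2, hpq₀.1, hpq₀.2]
    have hqq : 2 * ((q : ℝ) * q₀) < a i ^ t := by nlinarith [sq_nonneg ((q : ℝ) - q₀)]
    have hlt : |((p * q₀ - p₀ * q : ℤ) : ℝ)| < 1 := by
      have h1 : ((p * q₀ - p₀ * q : ℤ) : ℝ) = ((p : ℝ) / q - p₀ / q₀) * (q * q₀) := by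
        push_cast
        field_simp
      rw [h1, abs_mul, abs_of_pos (mul_pos hqR hq₀R)]
      have h2 : cellSide a t i * a i ^ t = 1 := by
        have := zero_lt_one.trans (ha1 i)
        unfold cellSide
        field_simp
      calc |(p : ℝ) / q - p₀ / q₀| * (q * q₀) ≤ 2 * cellSide a t i * (q * q₀) := by gcongr
        _ = cellSide a t i * (2 * (q * q₀)) := by ring
        _ < cellSide a t i * a i ^ t := by gcongr
        _ = 1 := h2
    have hz : p * q₀ - p₀ * q = 0 := Int.abs_lt_one_iff.1 (by exact_mod_cast hlt)
    rw [div_eq_div_iff hqR.ne' hq₀R.ne']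
    exact_mod_cast sub_eq_zero.1 hz

/-- The upper bound `hv` leaves one possible integer `b` per box, while the lower bound on some
coordinate of `v m` makes the form vary by at least `(a i ^ 2)⁻¹`, much more than `δ`. -/
lemma ncard_labels_meeting_linearObstacle_le {a : ι → ℝ}
    (ha : ∀ i, 8 * (Fintype.card ι + 1 : ℝ) * (2 * Fintype.card ι + 1) ≤ a i) (t : ℕ)
    (c : ι → ℝ) {v : ℕ → ι → ℤ} (hv : ∀ m i, |(v m i : ℝ)| ≤ a i ^ m) {δ : ℝ}
    (hδ1 : δ ≤ 1 / 16)
    (hδ : ∀ i, δ ≤ (a i ^ 2)⁻¹ / (16 * (Fintype.card ι + 1))) :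
    2 * (Fintype.card ι + 1) * {k ∈ (labels a : Set (ι → ℕ)) |
      (cell a (t + 1) (childCorner a t c k) ∩ linearObstacle a v δ t c).Nonempty}.ncard ≤
        (labels a).card := by
  classical
  rcases (linearObstacle a v δ t c).eq_empty_or_nonempty with
    h0 | ⟨x₀, hx₀, m, rfl, ⟨i₁, hi₁⟩, b₀, hb₀⟩
  · simp [h0]
  have hn0 : (0 : ℝ) ≤ Fintype.card ι := Nat.cast_nonneg _
  have ha1 : ∀ i, 1 < a i := fun i => lt_of_lt_of_le (by nlinarith) (ha i)
  obtain ⟨i₀, -, hi₀⟩ := Finset.exists_max_image Finset.univ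
    (fun i => |(v m i : ℝ)| * cellSide a (m + 1) i) ⟨i₁, Finset.mem_univ _⟩
  have hW : (a i₁ ^ 2)⁻¹ ≤ |(v m i₀ : ℝ)| * cellSide a (m + 1) i₀ := by
    refine le_trans ?_ (hi₀ i₁ (Finset.mem_univ _))
    have h0 : 0 < a i₁ := zero_lt_one.trans (ha1 i₁)
    rw [cellSide, inv_le_iff_one_le_mul₀ (by positivity)]
    have h1 : |(v m i₁ : ℝ)| * (a i₁ ^ (m + 1))⁻¹ * a i₁ ^ 2 = a i₁ * |(v m i₁ : ℝ)| / a i₁ ^ m := by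
      field_simp
      ring
    rw [h1, le_div_iff₀ (by positivity)]
    linarith
  have hWpos : 0 < |(v m i₀ : ℝ)| * cellSide a (m + 1) i₀ := by
    have h0 : 0 < a i₁ := zero_lt_one.trans (ha1 i₁)
    exact lt_of_lt_of_le (by positivity) hW
  refine ncard_labels_meeting_le_of_subset_slab ha (m + 1) c (fun i => v m i) b₀ δ i₀ ?_ ?_
    (fun i => hi₀ i (Finset.mem_univ _)) ?_
  · intro h
    simp [h] at hWpos
  · refine (hδ i₁).trans ?_
    gcongr
  · rintro x ⟨hx, m', hm', -, b, hb⟩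
    obtain rfl : m = m' := by omega
    have h1 := abs_sum_mul_sub_le_of_mem_cell hx hx₀ fun i => (v m i : ℝ)
    -- Using level `m + 1` rather than `m` gains a factor `1 / a i` in each term.
    have h2 : ∑ i, |(v m i : ℝ)| * cellSide a (m + 1) i ≤ 1 / 8 := by
      set D : ℝ := 8 * (Fintype.card ι + 1 : ℝ) * (2 * Fintype.card ι + 1) with hD
      have hD0 : 0 < D := by positivity
      have h3 : ∀ i ∈ Finset.univ, |(v m i : ℝ)| * cellSide a (m + 1) i ≤ 1 / D := by
        intro i _
        have h0 : 0 < a i := zero_lt_one.trans (ha1 i)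
        rw [cellSide, ← div_eq_mul_inv, div_le_div_iff₀ (by positivity) hD0, one_mul, pow_succ]
        have := hv m i
        have := ha i
        gcongr
      refine (Finset.sum_le_card_nsmul _ _ _ h3).trans ?_
      rw [Finset.card_univ, nsmul_eq_mul, mul_one_div, div_le_iff₀ hD0, hD]
      nlinarith
    have h4 : |((b - b₀ : ℤ) : ℝ)| < 1 := by
      push_cast
      rw [abs_lt] at hb hb₀ ⊢
      rw [abs_le] at h1
      constructor <;> linarith [hb.1, hb.2, hb₀.1, hb₀.2, h1.1, h1.2]
    have h5 : b - b₀ = 0 := Int.abs_lt_one_iff.1 (by exact_mod_cast h4)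
    rw [sub_eq_zero] at h5
    subst h5
    exact hb

lemma ncard_labels_meeting_obstacles_le {a : ι → ℝ}
    (ha : ∀ i, 8 * (Fintype.card ι + 1 : ℝ) * (2 * Fintype.card ι + 1) ≤ a i) (t : ℕ)
    (c : ι → ℝ) {v : ℕ → ι → ℤ} (hv : ∀ m i, |(v m i : ℝ)| ≤ a i ^ m) {δ ε : ℝ}
    (hε : ε ≤ 1 / (16 * (Fintype.card ι + 1))) (hδ1 : δ ≤ 1 / 16)
    (hδ : ∀ i, δ ≤ (a i ^ 2)⁻¹ / (16 * (Fintype.card ι + 1))) :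
    2 * {k ∈ (labels a : Set (ι → ℕ)) | (cell a (t + 1) (childCorner a t c k) ∩
      (linearObstacle a v δ t c ∪ ⋃ i, rationalObstacle a ε t c i)).Nonempty}.ncard ≤
        (labels a).card := by
  set n := Fintype.card ι
  set M : Set (ι → ℝ) → Set (ι → ℕ) := fun B => {k ∈ (labels a : Set (ι → ℕ)) |
    (cell a (t + 1) (childCorner a t c k) ∩ B).Nonempty} with hM
  have hfin : ∀ B, (M B).Finite := fun B => (labels a).finite_toSet.subset fun k hk => hk.1
  have hsub : M (linearObstacle a v δ t c ∪ ⋃ i, rationalObstacle a ε t c i) ⊆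
      M (linearObstacle a v δ t c) ∪ ⋃ i, M (rationalObstacle a ε t c i) := by
    rintro k ⟨hk, x, hx, hx' | hx'⟩
    · exact Or.inl ⟨hk, x, hx, hx'⟩
    · obtain ⟨i, hi⟩ := mem_iUnion.1 hx'
      exact Or.inr (mem_iUnion.2 ⟨i, hk, x, hx, hi⟩)
  have h1 : (M (linearObstacle a v δ t c ∪ ⋃ i, rationalObstacle a ε t c i)).ncard ≤
      (M (linearObstacle a v δ t c)).ncard + ∑ i, (M (rationalObstacle a ε t c i)).ncard :=
    (ncard_le_ncard hsub ((hfin _).union (finite_iUnion fun _ => hfin _))).trans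
      ((ncard_union_le _ _).trans (by gcongr; exact ncard_iUnion_le_of_fintype _))
  have h2 : 2 * (n + 1) * (M (linearObstacle a v δ t c)).ncard ≤ (labels a).card :=
    ncard_labels_meeting_linearObstacle_le ha t c hv hδ1 hδ
  have h3 : ∑ i, 2 * (n + 1) * (M (rationalObstacle a ε t c i)).ncard ≤ n * (labels a).card := by
    refine (Finset.sum_le_card_nsmul _ _ _ fun i _ =>
      ncard_labels_meeting_rationalObstacle_le ha t c i hε).trans_eq ?_
    rw [Finset.card_univ, smul_eq_mul]
  rw [← Finset.mul_sum] at h3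
  change 2 * (M _).ncard ≤ _
  refine le_of_mul_le_mul_left (a := n + 1) ?_ (Nat.succ_pos _)
  nlinarith

-- Each denominator `q` is handled at the one level `k + 1` with `a i ^ k ≤ 2 * q ^ 2 < a i ^ (k +
-- 1)`, where the side of the box is comparable to `1 / q ^ 2`.
omit [Fintype ι] in
lemma exists_le_mul_abs_sub_of_forall_notMem {a : ι → ℝ} {ε : ℝ} (ha : ∀ i, 1 < a i) (hε : 0 < ε)
    {x : ι → ℝ} (i : ι)
    (hx : ∀ t, ∃ c, x ∈ cell a t c ∧ x ∉ rationalObstacle a ε t c i) :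
    ∃ κ > 0, ∀ (q : ℕ) (p : ℤ), 0 < q → κ ≤ q * |q * x i - p| := by
  have h0 : 0 < a i := zero_lt_one.trans (ha i)
  refine ⟨ε / (2 * a i), by positivity, fun q p hq => ?_⟩
  have hq1 : (1 : ℝ) ≤ q := by exact_mod_cast hq
  have hq0 : (0 : ℝ) < q := by linarith
  obtain ⟨k, hk1, hk2⟩ := exists_nat_pow_near (x := 2 * (q : ℝ) ^ 2) (y := a i) (by nlinarith) (ha i)
  obtain ⟨c, hc, hcx⟩ := hx (k + 1)
  have h1 : ε * cellSide a (k + 1) i ≤ |x i - p / q| := by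
    by_contra! hcon
    refine hcx ⟨hc, p, q, hq, ?_, hk2, hcon⟩
    rw [pow_succ]
    gcongr
  have h2 : |x i - p / q| = |q * x i - p| / q := by
    rw [eq_div_iff hq0.ne', ← abs_of_pos hq0, ← abs_mul, abs_of_pos hq0]
    congr 1
    field_simp
  have h3 : ε / (2 * q ^ 2 * a i) ≤ ε * cellSide a (k + 1) i := by
    rw [cellSide, ← div_eq_mul_inv]
    have : a i ^ (k + 1) ≤ 2 * q ^ 2 * a i := by
      rw [pow_succ]
      gcongr
    gcongr
  rw [h2] at h1
  have h4 := h3.trans h1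
  rw [div_le_div_iff₀ (by positivity) hq0] at h4
  rw [div_le_iff₀ (by positivity)]
  have h5 : q * ε ≤ q * (q * |q * x i - p| * (2 * a i)) := by linarith
  exact le_of_mul_le_mul_left h5 hq0

/-- Transference: if the forms `v m` are bounded away from the integers at `x`, then `x` is
badly approximable in the twisted sense. -/
lemma exists_le_rpow_mul_distNearestInt [Nonempty ι] {R : ℝ} (hR : 1 < R) {j : ι → ℝ}
    (hj : ∀ i, 0 < j i) (hj1 : ∀ i, j i ≤ 1) (θ x : ι → ℝ) {δ : ℝ} (hδ0 : 0 < δ) (hδ1 : δ < 1)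
    (v : ℕ → ι → ℤ) (hv : ∀ m i, |(v m i : ℝ)| ≤ (R ^ j i) ^ m)
    (hx : ∀ m, ∃ m₀ ≤ m, distNearestInt (∑ i, v m₀ i * θ i) ≤ 2 / R ^ m ∧
      ∀ b : ℤ, δ ≤ |∑ i, v m₀ i * x i - b|) :
    ∃ κ > 0, ∀ q : ℕ, 0 < q → ∃ i, κ ≤ (q : ℝ) ^ j i * distNearestInt (q * θ i - x i) := by
  have hR0 : 0 < R := zero_lt_one.trans hR
  set n := Fintype.card ι with hn
  have hnpos : (0 : ℝ) < n := by exact_mod_cast Fintype.card_pos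
  refine ⟨δ / (2 * n) / (4 * R / δ), by positivity, fun q hq => ?_⟩
  have hq1 : (1 : ℝ) ≤ q := by exact_mod_cast hq
  -- This is the least order of magnitude for which `q * (2 / R ^ (k + 1)) ≤ δ / 2`; minimality of
  -- `k` later bounds the coefficients of the form.
  obtain ⟨k, hk1, hk2⟩ := exists_nat_pow_near (x := 4 * q / δ) (y := R)
    (by rw [le_div_iff₀ hδ0]; linarith) hR
  obtain ⟨m₀, hm₀, hd, hb⟩ := hx (k + 1)
  set F := ∑ i, (v m₀ i : ℝ) * θ i with hF
  -- The integer that turns the identity `v·x = q (v·θ) - v·(qθ - x)` into one between signed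
  -- distances to nearest integers.
  set b : ℤ := q * round F - ∑ i, v m₀ i * round (q * θ i - x i) with hbdef
  have hid : ∑ i, v m₀ i * x i - b = q * (F - round F) -
      ∑ i, v m₀ i * ((q * θ i - x i) - round (q * θ i - x i)) := by
    rw [hbdef, hF]
    push_cast
    simp only [mul_sub, Finset.sum_sub_distrib, Finset.mul_sum]
    have : ∑ i, (v m₀ i : ℝ) * (q * θ i) = ∑ i, (q : ℝ) * (v m₀ i * θ i) :=
      Finset.sum_congr rfl fun i _ => by ring
    rw [this]
    ring
  have h1 : (q : ℝ) * |F - round F| ≤ δ / 2 := by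
    have h2 : |F - round F| ≤ 2 / R ^ (k + 1) := hd
    refine (mul_le_mul_of_nonneg_left h2 (by linarith)).trans ?_
    rw [div_lt_iff₀ hδ0] at hk2
    rw [← mul_div_assoc, div_le_iff₀ (by positivity)]
    linarith
  have h2 : δ / 2 ≤ ∑ i, |(v m₀ i : ℝ)| * distNearestInt (q * θ i - x i) := by
    have h3 := hb b
    rw [hid] at h3
    have h4 := h3.trans (abs_sub _ _)
    rw [abs_mul, Nat.abs_cast] at h4
    have h5 : |∑ i, v m₀ i * ((q * θ i - x i) - round (q * θ i - x i))| ≤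
        ∑ i, |(v m₀ i : ℝ)| * distNearestInt (q * θ i - x i) := by
      refine (Finset.abs_sum_le_sum_abs _ _).trans_eq ?_
      exact Finset.sum_congr rfl fun i _ => abs_mul _ _
    linarith
  obtain ⟨i, -, hi⟩ : ∃ i ∈ Finset.univ,
      δ / (2 * n) ≤ |(v m₀ i : ℝ)| * distNearestInt (q * θ i - x i) := by
    refine Finset.exists_le_of_sum_le Finset.univ_nonempty ?_
    rw [Finset.sum_const, Finset.card_univ, nsmul_eq_mul, ← hn]
    refine le_trans (le_of_eq ?_) h2
    field_simp
  refine ⟨i, ?_⟩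
  have hdn : 0 ≤ distNearestInt (q * θ i - x i) := abs_nonneg _
  have h6 : |(v m₀ i : ℝ)| ≤ (q : ℝ) ^ j i * (4 * R / δ) := by
    have hRj : 1 ≤ R ^ j i := Real.one_le_rpow hR.le (hj i).le
    refine (hv m₀ i).trans ((pow_le_pow_right₀ hRj hm₀).trans ?_)
    rw [← Real.rpow_natCast, ← Real.rpow_mul hR0.le, mul_comm, Real.rpow_mul hR0.le,
      Real.rpow_natCast]
    have h7 : R ^ (k + 1) ≤ q * (4 * R / δ) := by
      rw [pow_succ]
      calc R ^ k * R ≤ 4 * q / δ * R := by gcongr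
        _ = _ := by ring
    refine (Real.rpow_le_rpow (by positivity) h7 (hj i).le).trans ?_
    rw [Real.mul_rpow (by positivity) (by positivity)]
    gcongr
    refine Real.rpow_le_self_of_one_le ?_ (hj1 i)
    rw [le_div_iff₀ hδ0]
    linarith
  rw [div_le_iff₀ (by positivity)]
  calc _ ≤ |(v m₀ i : ℝ)| * distNearestInt (q * θ i - x i) := hi
    _ ≤ ((q : ℝ) ^ j i * (4 * R / δ)) * distNearestInt (q * θ i - x i) := by gcongr
    _ = _ := by ring

/-- Sets of dimension arbitrarily close to the full dimension, consisting of twisted badly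
approximable vectors with badly approximable coordinates. -/
theorem exists_dimH_ge_badlyApproximable [Nonempty ι] {j : ι → ℝ} (hj : ∀ i, 0 < j i)
    (hsum : ∑ i, j i = 1) (θ : ι → ℝ) {s : ℝ≥0} (hs : 0 < s) (hsn : (s : ℝ) < Fintype.card ι) :
    ∃ X : Set (ι → ℝ), s ≤ dimH X ∧ ∀ x ∈ X,
      (∃ κ > 0, ∀ q : ℕ, 0 < q → ∃ i, κ ≤ (q : ℝ) ^ j i * distNearestInt (q * θ i - x i)) ∧
      ∀ i, ∃ κ > 0, ∀ q : ℕ, 0 < q → κ ≤ q * distNearestInt (q * x i) := by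
  set n := Fintype.card ι with hn
  have hn0 : (0 : ℝ) ≤ n := Nat.cast_nonneg n
  set D := 8 * (n + 1 : ℝ) * (2 * n + 1) with hD
  have hD8 : 8 ≤ D := by rw [hD]; nlinarith
  obtain ⟨β, hβD, hβ⟩ : ∃ β, D ≤ β ∧ 8 ^ n * 2 ≤ β ^ ((n - s : ℝ) / 2) :=
    ((Filter.eventually_ge_atTop D).and ((tendsto_rpow_atTop
      (show 0 < (n - s : ℝ) / 2 by linarith)).eventually_ge_atTop _)).exists
  have hβ1 : 1 < β := by linarith
  have hj1 : ∀ i, j i ≤ 1 := fun i =>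
    (Finset.single_le_sum (fun i _ => (hj i).le) (Finset.mem_univ i)).trans_eq hsum
  obtain ⟨i₀, hi₀⟩ := Finite.exists_min j
  -- With `j i₀` the least weight, the smallest ratio `a i₀` is exactly `β`.
  set R := β ^ (1 / j i₀) with hRdef
  have hR1 : 1 < R := Real.one_lt_rpow hβ1 (one_div_pos.2 (hj i₀))
  have hR0 : 0 < R := zero_lt_one.trans hR1
  set a : ι → ℝ := fun i => R ^ j i with hadef
  have haβ : ∀ i, β ≤ a i := fun i => by
    have h1 : R ^ j i₀ = β := by
      rw [hRdef, ← Real.rpow_mul (by linarith), one_div_mul_cancel (hj i₀).ne', Real.rpow_one]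
    rw [← h1]
    exact Real.rpow_le_rpow_of_exponent_le hR1.le (hi₀ i)
  have ha1 : ∀ i, 1 < a i := fun i => hβ1.trans_le (haβ i)
  have haprod : ∏ i, a i = R := by
    rw [hadef, ← Real.rpow_sum_of_pos hR0, hsum, Real.rpow_one]
  have haR : ∀ i, a i ≤ R := fun i =>
    (Real.rpow_le_rpow_of_exponent_le hR1.le (hj1 i)).trans_eq (Real.rpow_one R)
  obtain ⟨v, hv, hvθ⟩ := exists_bestApproximations θ a fun i => (ha1 i).le
  set ε : ℝ := 1 / (16 * (n + 1)) with hε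
  have hε0 : 0 < ε := by positivity
  have hε1 : ε ≤ 1 / 16 := by rw [hε]; gcongr; linarith
  -- Since `a i ≤ R`, this one `δ` serves for every coordinate.
  set δ : ℝ := (R ^ 2)⁻¹ / (16 * (n + 1)) with hδ
  have hδ0 : 0 < δ := by positivity
  have hδε : δ ≤ ε := by
    rw [hδ, hε]
    gcongr
    exact inv_le_one_of_one_le₀ (one_le_pow₀ hR1.le)
  have hδa : ∀ i, δ ≤ (a i ^ 2)⁻¹ / (16 * (n + 1)) := fun i => by
    have h1 := haR i
    have h2 := zero_lt_one.trans (ha1 i)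
    rw [hδ]
    gcongr
  obtain ⟨X, hX, hXbad⟩ := exists_dimH_ge_forall_notMem hβ1 haβ hs hsn hβ
    (fun t c => linearObstacle a v δ t c ∪ ⋃ i, rationalObstacle a ε t c i)
    (fun t c => ncard_labels_meeting_obstacles_le (fun i => hβD.trans (haβ i)) t c hv le_rfl
      (hδε.trans hε1) hδa)
  refine ⟨X, hX, fun x hx => ⟨?_, fun i => ?_⟩⟩
  · refine exists_le_rpow_mul_distNearestInt hR1 hj hj1 θ x hδ0 (by linarith) v hv fun m => ?_
    obtain ⟨m₀, hm₀, hfresh, hd⟩ := hvθ m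
    refine ⟨m₀, hm₀, by rwa [haprod] at hd, fun b => ?_⟩
    obtain ⟨c, hc, hcx⟩ := hXbad x hx (m₀ + 1)
    by_contra! hcon
    exact hcx (Or.inl ⟨hc, m₀, rfl, hfresh, b, hcon⟩)
  · obtain ⟨κ, hκ, h⟩ := exists_le_mul_abs_sub_of_forall_notMem ha1 hε0 (x := x) i fun t => by
      obtain ⟨c, hc, hcx⟩ := hXbad x hx t
      exact ⟨c, hc, fun hmem => hcx (Or.inr (mem_iUnion.2 ⟨i, hmem⟩))⟩
    exact ⟨κ, hκ, fun q hq => h q _ hq⟩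

end Obstacles

/-! ### Transfer to Euclidean space -/

section Main

open Set
open scoped ENNReal NNReal

lemma mem_twistedBad_of_forall_le {n : ℕ} {θ x : EuclideanSpace ℝ (Fin n)} {j : Fin n → ℝ}
    {κ : ℝ} (hκ : 0 < κ)
    (h : ∀ q : ℕ, 0 < q → ∃ i, κ ≤ (q : ℝ) ^ j i * distNearestInt (q * θ i - x i)) :
    x ∈ twistedBad θ j := by
  refine hκ.trans_le (le_ciInf fun q => ?_)
  obtain ⟨i, hi⟩ := h q q.pos
  exact hi.trans (le_ciSup (f := fun i => ((q : ℕ) : ℝ) ^ j i *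
    distNearestInt (((q : ℕ) : ℝ) * θ i - x i)) (Set.finite_range _).bddAbove i)

lemma mem_Bad_single_of_forall_le {n : ℕ} {x : EuclideanSpace ℝ (Fin n)} {i : Fin n}
    {κ : ℝ} (hκ : 0 < κ) (h : ∀ q : ℕ, 0 < q → κ ≤ q * distNearestInt (q * x i)) :
    x ∈ Bad (Pi.single i (1 : ℝ)) := by
  refine hκ.trans_le (le_ciInf fun q => ?_)
  have hi : 0 < (Pi.single i (1 : ℝ) : Fin n → ℝ) i := by simp
  refine le_trans ?_ (le_ciSup
    (f := fun i' : {i' : Fin n // 0 < (Pi.single i (1 : ℝ) : Fin n → ℝ) i'} => ((q : ℕ) : ℝ) ^ (Pi.single i (1 : ℝ) : Fin n → ℝ) i' *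
      distNearestInt (((q : ℕ) : ℝ) * x i')) (Set.finite_range _).bddAbove ⟨i, hi⟩)
  simpa using h q q.pos

theorem theorem1 (n : ℕ) (θ : EuclideanSpace ℝ (Fin n)) (j : Fin n → ℝ)
    (hj : ∀ i, 0 < j i) (hsum : ∑ i, j i = 1) :
    dimH (twistedBad θ j ∩ ⋂ i : Fin n, Bad (Pi.single i (1 : ℝ))) = (n : ENNReal) ∧
      dimH (twistedBad θ j) = (n : ENNReal) := by
  have hne : Nonempty (Fin n) := by
    by_contra h
    rw [not_nonempty_iff] at h
    simp at hsum
  have hupper : ∀ S : Set (EuclideanSpace ℝ (Fin n)), dimH S ≤ n := fun S =>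
    (dimH_mono (subset_univ S)).trans_eq (by rw [Real.dimH_univ_eq_finrank]; simp)
  have hlower : (n : ℝ≥0∞) ≤
      dimH (twistedBad θ j ∩ ⋂ i : Fin n, Bad (Pi.single i (1 : ℝ))) := by
    refine le_of_forall_lt_imp_le_of_dense fun r hr => ?_
    rcases eq_or_ne r 0 with rfl | hr0
    · exact zero_le
    lift r to ℝ≥0 using (hr.trans ENNReal.coe_lt_top).ne
    have hrn : (r : ℝ) < Fintype.card (Fin n) := by
      rw [Fintype.card_fin]
      exact_mod_cast hr
    obtain ⟨X, hX, hXbad⟩ := exists_dimH_ge_badlyApproximable hj hsum (fun i => θ i)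
      (pos_iff_ne_zero.2 (by exact_mod_cast hr0)) hrn
    -- The Cantor set lives in the sup metric; a continuous linear equivalence preserves its
    -- dimension.
    rw [← (EuclideanSpace.equiv (Fin n) ℝ).symm.dimH_image X] at hX
    refine hX.trans (dimH_mono ?_)
    rintro _ ⟨x, hx, rfl⟩
    obtain ⟨⟨κ, hκ, h1⟩, h2⟩ := hXbad x hx
    refine ⟨mem_twistedBad_of_forall_le hκ h1, mem_iInter.2 fun i => ?_⟩
    obtain ⟨κ', hκ', h3⟩ := h2 i
    exact mem_Bad_single_of_forall_le hκ' h3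
  exact ⟨le_antisymm (hupper _) hlower,
    le_antisymm (hupper _) (hlower.trans (dimH_mono inter_subset_left))⟩

end Main
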